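/- For $i\ge 1$ let $p_i$ be the $i$-th prime number ($p_1=2$), and for $k\ge 1$ put $p(k)=p_{k+2}$, so that $p(1)=5,\ p(2)=7,\ p(3)=11,\dots$ Let $T=(a(k;n))_{k,n\ge 1}$ be the infinite matrix with entries $$a(k;n)=p(k)\cdot\left(5+2\left\lfloor \frac n2\right\rfloor+4\left\lfloor\frac{n-1}2\right\rfloor\right).$$ An entry $a(k;n)$ is called leading if $a(k;n)=p(k)^2$; let $M_T$ be the set of all leading elements of $T$. For real $x$ let $\pi_{M_T}(x)$ be the number of elements of $M_T$ that are less than or equal to $x$, and let $\pi(x)$ be the number of primes less than or equal to $x$. Write $f(x)\sim g(x)$ as $x\to\infty$ if $\lim_{x\to\infty} f(x)/g(x)=1$. Then $$\pi_{M_T}(x)\sim\frac{2\sqrt x}{\ln x}\qquad(x\to\infty),$$ and consequently $$\pi(x)\sim\frac{\sqrt x}{2}\cdot\pi_{M_T}(x)\qquad(x\to\infty).$$ -/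

import Mathlib

namespace TMatrix

/-- The `i`-th prime number `p_i`, counted from `p_1 = 2`. -/
noncomputable def nthPrime (i : ℕ+) : ℕ := Nat.nth Nat.Prime ((i : ℕ) - 1)

/-- The sequence `p(k) = p_{k+2}` for `k = 1, 2, …`: the primes `5, 7, 11, …`. -/
noncomputable def p (k : ℕ+) : ℕ := nthPrime (k + 2)

/-- The infinite matrix `T`, with rows and columns numbered from `1` and entries
`a(k;n) = p(k) * (5 + 2 * ⌊n / 2⌋ + 4 * ⌊(n - 1) / 2⌋)`. Division on `ℕ` is the floor of the
quotient. -/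
noncomputable def T : Matrix ℕ+ ℕ+ ℕ :=
  Matrix.of fun k n => p k * (5 + 2 * ((n : ℕ) / 2) + 4 * (((n : ℕ) - 1) / 2))

/-- The entry of `T` in row `k` and column `n` is leading if it equals `p(k) ^ 2`. -/
def IsLeading (k n : ℕ+) : Prop := T k n = p k ^ 2

/-- The set `M_T` of all leading elements of `T`. -/
def leadingElements : Set ℕ := {a | ∃ k n : ℕ+, IsLeading k n ∧ T k n = a}

/-- `π_{M_T}(x)`: the number of leading elements of `T` that are at most `x`. -/
noncomputable def leadingCounting (x : ℝ) : ℕ :=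
  {a : ℕ | a ∈ leadingElements ∧ (a : ℝ) ≤ x}.ncard

/-- `π(x)` for a real number `x`: the number of primes that are at most `x`. -/
noncomputable def primePi (x : ℝ) : ℕ := Nat.primeCounting ⌊x⌋₊

/-- Asymptotic equality `f(x) ∼ g(x)` as `x → ∞`: the quotient `f(x) / g(x)` tends to `1`. -/
def AsympEq (f g : ℝ → ℝ) : Prop :=
  Filter.Tendsto (fun x => f x / g x) Filter.atTop (nhds 1)

end TMatrix

/-! The column factors run through 5, 7, 11, 13, ..., all integers at least 5 coprime to 6, so each
row contains its leading entry and the leading elements are the squares of the primes at least 5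
(`leadingElements_eq`). Hence the count at `x` is `π(√x) - 2` for `x ≥ 9`, and both claims follow
from the prime number theorem.

That theorem is proved by a Wiener–Ikehara argument for `g t = ψ(e^t) e^(-t) - 1`. Its Laplace
transform extends continuously to the closed half-plane, since `-ζ'/ζ(s) - 1/(s-1)` does so on `Re s
≥ 1`. Parseval and Riemann–Lebesgue make the Fejér means of `g` vanish at infinity
(`tendsto_fejer_of_laplace`), and monotonicity of `ψ` upgrades this to `g → 0`
(`tendsto_zero_of_tendsto_fejer`). Comparing `ψ` with `θ`, and `θ / log` with `π`, finishes. -/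

open Filter MeasureTheory Set Topology

/-! ### Fejér means and the real-variable Tauberian step -/

namespace TMatrix

/-- The Fejér kernel, the Fourier transform of the triangle function `1 - |y|` on `[-1, 1]`
(up to the value at `0`). -/
noncomputable def fejer (u : ℝ) : ℝ := 2 * (1 - Real.cos u) / u ^ 2

lemma fejer_nonneg (u : ℝ) : 0 ≤ fejer u :=
  div_nonneg (by linarith [Real.cos_le_one u]) (sq_nonneg u)

lemma measurable_fejer : Measurable fejer := by
  unfold fejer; fun_prop

lemma fejer_le (u : ℝ) : fejer u ≤ 5 * (1 + u ^ 2)⁻¹ := by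
  rcases eq_or_ne u 0 with rfl | hu
  · simp [fejer]
  have hu2 : 0 < u ^ 2 := by positivity
  rw [fejer, ← div_eq_mul_inv, div_le_div_iff₀ hu2 (by positivity)]
  have h1 := Real.one_sub_sq_div_two_le_cos (x := u)
  have h2 := Real.neg_one_le_cos u
  -- The constant is 5 = 1 + 4: `2(1 - cos u) ≤ u²` and `2(1 - cos u) u² ≤ 4u²`.
  nlinarith

lemma integrable_fejer : Integrable fejer :=
  (integrable_inv_one_add_sq.const_mul 5).mono' measurable_fejer.aestronglyMeasurable
    (.of_forall fun u => by rw [Real.norm_of_nonneg (fejer_nonneg u)]; exact fejer_le u)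

lemma integral_fejer_pos : 0 < ∫ u, fejer u := by
  rw [integral_pos_iff_support_of_nonneg fejer_nonneg integrable_fejer]
  refine lt_of_lt_of_le ?_ (measure_mono (s := Ioo 0 1) fun u hu => ?_)
  · simp
  · have : Real.cos u < 1 := by
      have := Real.cos_lt_cos_of_nonneg_of_le_pi le_rfl
        (by linarith [hu.2, Real.pi_gt_three] : u ≤ Real.pi) hu.1
      simpa using this
    have hu0 := hu.1
    rw [Function.mem_support, fejer]
    have : 0 < 1 - Real.cos u := by linarith
    positivity

lemma integrable_fejer_scaled {l : ℝ} (hl : l ≠ 0) (T : ℝ) :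
    Integrable fun t => fejer (l * (t - T)) :=
  (integrable_fejer.comp_mul_left' hl).comp_sub_right T

lemma integral_triangle_mul_cexp {u : ℝ} (hu : u ≠ 0) :
    ∫ y in (-1 : ℝ)..1, ((1 - |y| : ℝ) : ℂ) * Complex.exp (-Complex.I * u * y) = fejer u := by
  have hu' : (u : ℂ) ≠ 0 := by exact_mod_cast hu
  have hi : ∀ a b : ℝ, IntervalIntegrable
      (fun y : ℝ => ((1 - |y| : ℝ) : ℂ) * Complex.exp (-Complex.I * u * y)) volume a b := fun a b =>
    Continuous.intervalIntegrable (by fun_prop) _ _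
  rw [← intervalIntegral.integral_add_adjacent_intervals (hi (-1) 0) (hi 0 1)]
  -- One antiderivative serves both halves: `1 - |y| = 1 - e y` with `e = -1` on the left and `e =
  -- 1` on the right.
  have key : ∀ e : ℂ, ∀ y : ℝ, HasDerivAt (fun y : ℝ =>
      (-(1 - e * y) / (Complex.I * u) + e / (Complex.I * u) ^ 2)
        * Complex.exp (-Complex.I * u * y))
      ((1 - e * y) * Complex.exp (-Complex.I * u * y)) y := by
    intro e y
    have h1 : HasDerivAt (fun y : ℝ => (y : ℂ)) 1 y := Complex.ofRealCLM.hasDerivAt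
    have h2 := ((((h1.const_mul e).const_sub 1).neg.div_const (Complex.I * u)).add_const
      (e / (Complex.I * u) ^ 2)).mul ((h1.const_mul (-Complex.I * u)).cexp)
    refine h2.congr_deriv ?_
    simp only [Pi.neg_apply]
    field_simp
    ring_nf
  have e1 : ∫ y in (-1 : ℝ)..0, ((1 - |y| : ℝ) : ℂ) * Complex.exp (-Complex.I * u * y)
      = ∫ y in (-1 : ℝ)..0, (1 - (-1) * (y : ℂ)) * Complex.exp (-Complex.I * u * y) := by
    refine intervalIntegral.integral_congr fun y hy => ?_
    rw [uIcc_of_le (by norm_num)] at hy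
    simp [abs_of_nonpos hy.2]
  have e2 : ∫ y in (0 : ℝ)..1, ((1 - |y| : ℝ) : ℂ) * Complex.exp (-Complex.I * u * y)
      = ∫ y in (0 : ℝ)..1, (1 - 1 * (y : ℂ)) * Complex.exp (-Complex.I * u * y) := by
    refine intervalIntegral.integral_congr fun y hy => ?_
    rw [uIcc_of_le (by norm_num)] at hy
    simp [abs_of_nonneg hy.1]
  rw [e1, e2, intervalIntegral.integral_eq_sub_of_hasDerivAt (fun y _ => key (-1) y)
      (Continuous.intervalIntegrable (by fun_prop) _ _),
    intervalIntegral.integral_eq_sub_of_hasDerivAt (fun y _ => key 1 y)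
      (Continuous.intervalIntegrable (by fun_prop) _ _)]
  have hcos : (2 : ℂ) * Real.cos u
      = Complex.exp (Complex.I * u) + Complex.exp (-(Complex.I * u)) := by
    rw [Complex.ofReal_cos, Complex.cos]; ring_nf
  rw [fejer]
  push_cast at hcos ⊢
  rw [mul_sub, hcos]
  simp only [mul_pow, Complex.I_sq]
  simp
  field_simp
  ring_nf

lemma tendsto_integral_fejer_tail :
    Tendsto (fun R : ℝ => ∫ u, {u : ℝ | R < |u|}.indicator fejer u) atTop (𝓝 0) := by
  have : Tendsto (fun R : ℝ => ∫ u, {u : ℝ | R < |u|}.indicator fejer u) atTop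
      (𝓝 (∫ _ : ℝ, (0 : ℝ))) := by
    refine tendsto_integral_filter_of_dominated_convergence fejer
      (.of_forall fun R => (measurable_fejer.indicator
        (measurableSet_lt measurable_const measurable_norm)).aestronglyMeasurable)
      (.of_forall fun R => .of_forall fun u => ?_) integrable_fejer (.of_forall fun u => ?_)
    · exact (norm_indicator_le_norm_self _ _).trans_eq (Real.norm_of_nonneg (fejer_nonneg u))
    · refine tendsto_const_nhds.congr' ?_
      filter_upwards [eventually_ge_atTop |u|] with R hR
      exact (indicator_of_notMem (by simpa using hR) _).symm
  simpa using this

/-- A bounded function whose Fejér means vanish at infinity does not stay above a positive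
constant on intervals of fixed length far out. -/
lemma eventually_not_forall_le_of_tendsto_fejer {h : ℝ → ℝ} (hm : Measurable h) {M : ℝ}
    (hM : ∀ t, |h t| ≤ M)
    (hconv : ∀ l : ℝ, 0 < l →
      Tendsto (fun T => ∫ t, h t * fejer (l * (t - T))) atTop (𝓝 0))
    {c d : ℝ} (hc : 0 < c) (hd : 0 < d) :
    ∀ᶠ T in atTop, ¬ ∀ t, |t - T| ≤ d → c ≤ h t := by
  set C := ∫ u, fejer u with hC
  have hCpos : 0 < C := integral_fejer_pos
  have hM0 : 0 ≤ M := (abs_nonneg _).trans (hM 0)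
  have htail : ∀ᶠ R in atTop, (M + c) * ∫ u, {u : ℝ | R < |u|}.indicator fejer u < c * C / 2 := by
    have := tendsto_integral_fejer_tail.const_mul (M + c)
    rw [mul_zero] at this
    exact this.eventually_lt_const (by positivity)
  obtain ⟨R, hR, hR0⟩ := (htail.and (eventually_gt_atTop 0)).exists
  -- This scale maps `|t - T| ≤ d` onto `|u| ≤ R`, outside which the kernel has little mass.
  set l := R / d with hl
  have hl0 : 0 < l := by positivity
  have hlim := (hconv l hl0).eventually_lt_const (show 0 < l⁻¹ * (c * C / 2) by positivity)
  filter_upwards [hlim] with T hT hall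
  have hint := integrable_fejer_scaled hl0.ne' T
  have hms : MeasurableSet {u : ℝ | R < |u|} := measurableSet_lt measurable_const measurable_norm
  have hint2 : Integrable fun t => {u : ℝ | R < |u|}.indicator fejer (l * (t - T)) :=
    ((integrable_fejer.indicator hms).comp_mul_left' hl0.ne').comp_sub_right T
  have hsc : ∀ f : ℝ → ℝ, ∫ t, f (l * (t - T)) = l⁻¹ * ∫ u, f u := fun f => by
    rw [integral_sub_right_eq_self (fun t => f (l * t)) T, Measure.integral_comp_mul_left,
      abs_of_pos (inv_pos.2 hl0), smul_eq_mul]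
  -- Near `T` use `h ≥ c`; elsewhere `h ≥ -M = c - (M + c)`.
  have hle : ∫ t, (c * fejer (l * (t - T)) -
      (M + c) * {u : ℝ | R < |u|}.indicator fejer (l * (t - T)))
      ≤ ∫ t, h t * fejer (l * (t - T)) := by
    refine integral_mono ((hint.const_mul c).sub (hint2.const_mul (M + c)))
      (hint.bdd_mul hm.aestronglyMeasurable (.of_forall hM)) fun t => ?_
    have hf := fejer_nonneg (l * (t - T))
    by_cases ht : |t - T| ≤ d
    · have : l * (t - T) ∉ {u : ℝ | R < |u|} := by
        simp only [mem_ofPred_eq, not_lt, abs_mul, abs_of_pos hl0]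
        calc l * |t - T| ≤ l * d := by gcongr
          _ = R := by rw [hl]; field_simp
      simp only [indicator_of_notMem this]
      nlinarith [hall t ht]
    · have : l * (t - T) ∈ {u : ℝ | R < |u|} := by
        simp only [mem_ofPred_eq, abs_mul, abs_of_pos hl0]
        calc R = l * d := by rw [hl]; field_simp
          _ < l * |t - T| := by gcongr; exact not_le.1 ht
      simp only [indicator_of_mem this]
      nlinarith [(abs_le.1 (hM t)).1]
  rw [integral_sub (hint.const_mul c) (hint2.const_mul (M + c)), integral_const_mul,
    integral_const_mul, hsc, hsc] at hle
  have : l⁻¹ * ((M + c) * ∫ u, {u : ℝ | R < |u|}.indicator fejer u) < l⁻¹ * (c * C / 2) := by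
    gcongr
  nlinarith

/-- A bounded function `g` for which `t ↦ (g t + 1) * exp t` is increasing tends to `0` if its Fejér
means do. -/
lemma tendsto_zero_of_tendsto_fejer {g : ℝ → ℝ} (hm : Measurable g) {M : ℝ}
    (hM : ∀ t, |g t| ≤ M) (hmono : Monotone fun t => (g t + 1) * Real.exp t)
    (hconv : ∀ l : ℝ, 0 < l →
      Tendsto (fun T => ∫ t in Ioi 0, g t * fejer (l * (t - T))) atTop (𝓝 0)) :
    Tendsto g atTop (𝓝 0) := by
  set h := (Ioi (0 : ℝ)).indicator g with hh
  have hhm : Measurable h := hm.indicator measurableSet_Ioi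
  have hhM : ∀ t, |h t| ≤ M := fun t => (norm_indicator_le_norm_self g t).trans (hM t)
  have hhconv : ∀ l : ℝ, 0 < l →
      Tendsto (fun T => ∫ t, h t * fejer (l * (t - T))) atTop (𝓝 0) := fun l hl => by
    refine (hconv l hl).congr fun T => ?_
    rw [← integral_indicator measurableSet_Ioi]
    simp_rw [hh, indicator_mul_left]
  have hval : ∀ t, 0 < t → h t = g t := fun t ht => indicator_of_mem (mem_Ioi.2 ht) g
  rw [Metric.tendsto_nhds]
  intro ε' hε'
  set ε := min ε' 1 with hε
  have hε0 : 0 < ε := by positivity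
  have hε1 : ε ≤ 1 := min_le_right _ _
  -- If `g T ≥ ε`, then on `[T, T + 2d]` one has `g + 1 ≥ (1 + ε)(1 - ε/4) ≥ 1 + ε/2`, using `ε ≤
  -- 1`. Symmetrically, `g T ≤ -ε` forces `g ≤ -ε/2` on `[T - 2d, T]`. These intervals have centres
  -- `T ± d`, hence the shifts below.
  set d := ε / 8 with hd
  have hd0 : 0 < d := by positivity
  have up := (tendsto_atTop_add_const_right atTop d tendsto_id).eventually
    (eventually_not_forall_le_of_tendsto_fejer hhm hhM hhconv (half_pos hε0) hd0)
  have dn := (tendsto_atTop_add_const_right atTop (-d) tendsto_id).eventually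
    (eventually_not_forall_le_of_tendsto_fejer (h := fun t => -h t) hhm.neg
      (by simpa using hhM)
      (fun l hl => by simpa [integral_neg] using (hhconv l hl).neg) (half_pos hε0) hd0)
  filter_upwards [up, dn, eventually_gt_atTop (2 * d)] with T hup hdn hT
  refine lt_of_lt_of_le ?_ (min_le_left ε' 1)
  rw [← hε, Real.dist_eq, sub_zero, abs_lt]
  refine ⟨?_, ?_⟩
  · by_contra! hcon
    refine hdn fun t ht => ?_
    simp only [id_eq] at ht
    obtain ⟨h1, h2⟩ := abs_le.1 ht
    rw [hval t (by linarith)]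
    have hmn : (g t + 1) * Real.exp t ≤ (g T + 1) * Real.exp T := hmono (by linarith : t ≤ T)
    have he : Real.exp t = Real.exp T * Real.exp (t - T) := by rw [← Real.exp_add]; ring_nf
    have he2 : 1 - 2 * d ≤ Real.exp (t - T) := by
      linarith [Real.add_one_le_exp (t - T)]
    have hpos := Real.exp_pos T
    have h3 : (g t + 1) * Real.exp (t - T) ≤ g T + 1 := by
      rw [he] at hmn
      by_contra! hlt
      nlinarith
    by_contra! hlt
    nlinarith
  · by_contra! hcon
    refine hup fun t ht => ?_
    simp only [id_eq] at ht
    obtain ⟨h1, h2⟩ := abs_le.1 ht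
    rw [hval t (by linarith)]
    have hmn : (g T + 1) * Real.exp T ≤ (g t + 1) * Real.exp t := hmono (by linarith : T ≤ t)
    have he : Real.exp T = Real.exp t * Real.exp (T - t) := by rw [← Real.exp_add]; ring_nf
    have he2 : 1 - 2 * d ≤ Real.exp (T - t) := by
      linarith [Real.add_one_le_exp (T - t)]
    have hpos := Real.exp_pos t
    have h3 : (g T + 1) * Real.exp (T - t) ≤ g t + 1 := by
      rw [he] at hmn
      by_contra! hlt
      nlinarith
    nlinarith

end TMatrix

/-! ### From the Laplace transform to Fejér means -/

namespace TMatrix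

/-- Parseval's identity for the Laplace transform of a bounded function against the triangle
function. -/
lemma integral_triangle_mul_laplace {g : ℝ → ℝ} (hm : Measurable g) {M : ℝ}
    (hM : ∀ t, |g t| ≤ M) {H : ℂ → ℂ}
    (hlap : ∀ s : ℂ, 0 < s.re → ∫ t in Ioi (0 : ℝ), (g t : ℂ) * Complex.exp (-s * t) = H s)
    {l : ℝ} (hl : 0 < l) (T : ℝ) {σ : ℝ} (hσ : 0 < σ) :
    ∫ y in (-1 : ℝ)..1, ((1 - |y| : ℝ) : ℂ) * Complex.exp (Complex.I * (l * T) * y) *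
        H (σ + Complex.I * (l * y)) =
      ((∫ t in Ioi (0 : ℝ), g t * fejer (l * (t - T)) * Real.exp (-σ * t) : ℝ) : ℂ) := by
  set F : ℝ → ℝ → ℂ := fun y t => ((1 - |y| : ℝ) : ℂ) *
    (Complex.exp (-Complex.I * ((l * (t - T) : ℝ) : ℂ) * y) * ((g t * Real.exp (-σ * t) : ℝ) : ℂ))
    with hF
  have hFint : Integrable (Function.uncurry F)
      ((volume.restrict (Ioc (-1 : ℝ) 1)).prod (volume.restrict (Ioi (0 : ℝ)))) := by
    have hexp : Integrable (fun t : ℝ => Real.exp (-σ * t)) (volume.restrict (Ioi 0)) :=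
      integrableOn_exp_mul_Ioi (by linarith) 0
    have hge : Integrable (fun t : ℝ => g t * Real.exp (-σ * t)) (volume.restrict (Ioi 0)) :=
      hexp.bdd_mul hm.aestronglyMeasurable (.of_forall hM)
    have hy : Integrable (fun y : ℝ => ((1 - |y| : ℝ) : ℂ)) (volume.restrict (Ioc (-1 : ℝ) 1)) :=
      (Continuous.integrableOn_Icc (by fun_prop)).mono_set Ioc_subset_Icc_self
    have hprod := hy.mul_prod (hge.ofReal (𝕜 := ℂ))
    refine (hprod.bdd_mul (c := 1)
      (f := fun z : ℝ × ℝ => Complex.exp (-Complex.I * ((l * (z.2 - T) : ℝ) : ℂ) * z.1))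
      (Continuous.aestronglyMeasurable (by fun_prop)) (.of_forall fun z => ?_)).congr
      (.of_forall fun z => ?_)
    · rw [Complex.norm_exp]
      simp
    · exact mul_left_comm _ _ _
  have hL : ∀ y : ℝ, ((1 - |y| : ℝ) : ℂ) * Complex.exp (Complex.I * (l * T) * y) *
        H (σ + Complex.I * (l * y)) = ∫ t in Ioi (0 : ℝ), F y t := fun y => by
    rw [← hlap _ (by simpa using hσ), ← integral_const_mul]
    refine integral_congr_ae (.of_forall fun t => ?_)
    simp only [hF]
    push_cast
    rw [show -((σ : ℂ) + Complex.I * (l * y)) * t = -σ * t + -Complex.I * (l * y) * t by ring,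
      show -Complex.I * (l * (t - T)) * y = Complex.I * (l * T) * y + -Complex.I * (l * y) * t by
        ring, Complex.exp_add, Complex.exp_add]
    ring
  simp_rw [hL]
  rw [intervalIntegral.integral_of_le (by norm_num), integral_integral_swap hFint,
    ← integral_complex_ofReal]
  refine integral_congr_ae (ae_restrict_of_ae ?_)
  -- At `t = T` the kernel formula fails: `fejer 0 = 0` by division by zero, while the triangle has
  -- integral 1.
  filter_upwards [Measure.ae_ne volume T] with t ht
  rw [← intervalIntegral.integral_of_le (by norm_num)]
  simp only [hF, ← mul_assoc]
  rw [intervalIntegral.integral_mul_const,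
    integral_triangle_mul_cexp (mul_ne_zero hl.ne' (sub_ne_zero.2 ht))]
  push_cast
  ring

/-- The identity of `integral_triangle_mul_laplace` on the boundary line. -/
lemma integral_triangle_mul_laplace_boundary {g : ℝ → ℝ} (hm : Measurable g) {M : ℝ}
    (hM : ∀ t, |g t| ≤ M) {H : ℂ → ℂ} (hH : ContinuousOn H {s | 0 ≤ s.re})
    (hlap : ∀ s : ℂ, 0 < s.re → ∫ t in Ioi (0 : ℝ), (g t : ℂ) * Complex.exp (-s * t) = H s)
    {l : ℝ} (hl : 0 < l) (T : ℝ) :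
    ∫ y in (-1 : ℝ)..1, ((1 - |y| : ℝ) : ℂ) * Complex.exp (Complex.I * (l * T) * y) *
        H (Complex.I * (l * y)) =
      ((∫ t in Ioi (0 : ℝ), g t * fejer (l * (t - T)) : ℝ) : ℂ) := by
  have hint := integrable_fejer_scaled hl.ne' T
  have hgi : Integrable fun t => g t * fejer (l * (t - T)) :=
    hint.bdd_mul hm.aestronglyMeasurable (.of_forall hM)
  have hR : Tendsto (fun σ : ℝ =>
      ∫ t in Ioi (0 : ℝ), g t * fejer (l * (t - T)) * Real.exp (-σ * t)) (𝓝[>] 0)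
      (𝓝 (∫ t in Ioi (0 : ℝ), g t * fejer (l * (t - T)))) := by
    refine tendsto_integral_filter_of_dominated_convergence
      (fun t => ‖g t * fejer (l * (t - T))‖) (.of_forall fun σ => ?_) ?_ hgi.norm.integrableOn
      (.of_forall fun t => ?_)
    · exact (hgi.aestronglyMeasurable.mul
        (Continuous.aestronglyMeasurable (by fun_prop))).restrict
    · filter_upwards [self_mem_nhdsWithin] with σ hσ
      filter_upwards [ae_restrict_mem measurableSet_Ioi] with t ht
      rw [norm_mul, Real.norm_of_nonneg (Real.exp_pos _).le]
      refine mul_le_of_le_one_right (norm_nonneg _) (Real.exp_le_one_iff.2 ?_)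
      have := mul_pos (mem_Ioi.1 hσ) (mem_Ioi.1 ht)
      linarith
    · have : Tendsto (fun σ : ℝ => g t * fejer (l * (t - T)) * Real.exp (-σ * t)) (𝓝 0)
          (𝓝 (g t * fejer (l * (t - T)) * Real.exp (-0 * t))) :=
        Continuous.tendsto (by fun_prop) 0
      simpa using this.mono_left nhdsWithin_le_nhds
  -- A compact rectangle on which `H` is bounded, giving a dominating constant as `σ → 0+`.
  set P : Set ℂ := Icc 0 1 ×ℂ Icc (-l) l with hP
  have hPc : IsCompact P := isCompact_Icc.reProdIm isCompact_Icc
  have hPs : P ⊆ {s | 0 ≤ s.re} := fun s hs => (Complex.mem_reProdIm.1 hs).1.1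
  obtain ⟨B, hB⟩ := hPc.exists_bound_of_continuousOn (hH.mono hPs)
  have hmem : ∀ σ ∈ Icc (0 : ℝ) 1, ∀ y ∈ Ioc (-1 : ℝ) 1,
      (σ : ℂ) + Complex.I * (l * y) ∈ P := fun σ hσ y hy => by
    rw [hP, Complex.mem_reProdIm]
    constructor
    · simpa using hσ
    · simp only [Complex.add_im, Complex.ofReal_im, Complex.mul_im, Complex.I_re, Complex.I_im,
        Complex.mul_re, Complex.ofReal_re]
      constructor <;> nlinarith [hy.1, hy.2]
  have hL : Tendsto (fun σ : ℝ => ∫ y in (-1 : ℝ)..1,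
      ((1 - |y| : ℝ) : ℂ) * Complex.exp (Complex.I * (l * T) * y) * H (σ + Complex.I * (l * y)))
      (𝓝[>] 0) (𝓝 (∫ y in (-1 : ℝ)..1, ((1 - |y| : ℝ) : ℂ) *
        Complex.exp (Complex.I * (l * T) * y) * H (Complex.I * (l * y)))) := by
    simp_rw [intervalIntegral.integral_of_le (show (-1 : ℝ) ≤ 1 by norm_num)]
    have h01 : ∀ᶠ σ : ℝ in 𝓝[>] 0, σ ∈ Ioc (0 : ℝ) 1 := Ioc_mem_nhdsGT one_pos
    refine tendsto_integral_filter_of_dominated_convergence (fun _ => B) ?_ ?_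
      (integrable_const _) ?_
    · filter_upwards [h01] with σ hσ
      refine ContinuousOn.aestronglyMeasurable (ContinuousOn.mul (by fun_prop)
        (hH.comp (by fun_prop) fun y hy => hPs (hmem σ ⟨hσ.1.le, hσ.2⟩ y hy))) measurableSet_Ioc
    · filter_upwards [h01] with σ hσ
      filter_upwards [ae_restrict_mem measurableSet_Ioc] with y hy
      rw [norm_mul, norm_mul, Complex.norm_exp]
      have h1 : ‖((1 - |y| : ℝ) : ℂ)‖ ≤ 1 := by
        rw [Complex.norm_real, Real.norm_eq_abs, abs_le]
        have := abs_le.2 ⟨hy.1.le, hy.2⟩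
        constructor <;> linarith [abs_nonneg y]
      have h2 := hB _ (hmem σ ⟨hσ.1.le, hσ.2⟩ y hy)
      have h3 : (Complex.I * (l * T) * y).re = 0 := by simp
      rw [h3, Real.exp_zero, mul_one]
      calc _ ≤ 1 * B := by gcongr
        _ = B := one_mul B
    · filter_upwards [ae_restrict_mem measurableSet_Ioc] with y hy
      refine Tendsto.const_mul _ ?_
      have hc : ContinuousWithinAt (fun σ : ℝ => H (σ + Complex.I * (l * y))) (Ici 0) 0 := by
        refine ContinuousWithinAt.comp (t := {s : ℂ | 0 ≤ s.re}) (hH _ ?_) (by fun_prop) ?_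
        · simp
        · intro σ hσ
          simpa using hσ
      have := hc.tendsto.mono_left (nhdsWithin_mono _ Ioi_subset_Ici_self)
      simpa using this
  refine tendsto_nhds_unique hL ?_
  refine ((Complex.continuous_ofReal.tendsto _).comp hR).congr' ?_
  filter_upwards [self_mem_nhdsWithin] with σ hσ
  exact (integral_triangle_mul_laplace hm hM hlap hl T hσ).symm

/-- If the Laplace transform of a bounded function extends continuously to the closed right
half-plane, the Fejér means of the function vanish at infinity. -/
lemma tendsto_fejer_of_laplace {g : ℝ → ℝ} (hm : Measurable g) {M : ℝ}
    (hM : ∀ t, |g t| ≤ M) {H : ℂ → ℂ} (hH : ContinuousOn H {s | 0 ≤ s.re})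
    (hlap : ∀ s : ℂ, 0 < s.re → ∫ t in Ioi (0 : ℝ), (g t : ℂ) * Complex.exp (-s * t) = H s)
    {l : ℝ} (hl : 0 < l) :
    Tendsto (fun T => ∫ t in Ioi (0 : ℝ), g t * fejer (l * (t - T))) atTop (𝓝 0) := by
  have hRL := Real.tendsto_integral_exp_smul_cocompact ((Ioc (-1 : ℝ) 1).indicator
    fun y => ((1 - |y| : ℝ) : ℂ) * H (Complex.I * (l * y)))
  -- At this frequency the Fourier character, `exp(-2πi y w)`, equals `exp(i l T y)`.
  have hw : Tendsto (fun T : ℝ => -(l / (2 * Real.pi)) * T) atTop (cocompact ℝ) := by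
    refine Tendsto.mono_right ?_ atBot_le_cocompact
    refine tendsto_id.const_mul_atTop_of_neg ?_
    have := Real.pi_pos
    rw [neg_lt_zero]; positivity
  have h := (Complex.continuous_re.tendsto 0).comp (hRL.comp hw)
  rw [Complex.zero_re] at h
  refine h.congr fun T => ?_
  have hb := integral_triangle_mul_laplace_boundary hm hM hH hlap hl T
  rw [← Complex.ofReal_re (∫ t in Ioi (0 : ℝ), g t * fejer (l * (t - T))), ← hb,
    intervalIntegral.integral_of_le (by norm_num), ← integral_indicator measurableSet_Ioc]
  simp only [Function.comp_apply]
  congr 2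
  ext y
  by_cases hy : y ∈ Ioc (-1 : ℝ) 1
  · rw [indicator_of_mem hy, indicator_of_mem hy, Circle.smul_def, Real.fourierChar_apply,
      smul_eq_mul, show ((2 * Real.pi * -(y * (-(l / (2 * Real.pi)) * T)) : ℝ) : ℂ) * Complex.I
        = Complex.I * (l * T) * y by
          have : (Real.pi : ℂ) ≠ 0 := by exact_mod_cast Real.pi_ne_zero
          push_cast
          field_simp]
    ring
  · rw [indicator_of_notMem hy, indicator_of_notMem hy, smul_zero]

/-- A Tauberian theorem for bounded functions of controlled decrease. -/
theorem tendsto_zero_of_laplace {g : ℝ → ℝ} (hm : Measurable g) {M : ℝ}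
    (hM : ∀ t, |g t| ≤ M) (hmono : Monotone fun t => (g t + 1) * Real.exp t)
    {H : ℂ → ℂ} (hH : ContinuousOn H {s | 0 ≤ s.re})
    (hlap : ∀ s : ℂ, 0 < s.re → ∫ t in Ioi (0 : ℝ), (g t : ℂ) * Complex.exp (-s * t) = H s) :
    Tendsto g atTop (𝓝 0) :=
  tendsto_zero_of_tendsto_fejer hm hM hmono fun _ hl => tendsto_fejer_of_laplace hm hM hH hlap hl

end TMatrix

/-! ### The prime number theorem -/

namespace TMatrix

open Chebyshev

lemma integral_Ioi_one_eq_integral_exp (F : ℝ → ℂ) :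
    ∫ x in Ioi (1 : ℝ), F x = ∫ t in Ioi (0 : ℝ), (Real.exp t : ℂ) * F (Real.exp t) := by
  have himg : Real.exp '' Ioi 0 = Ioi 1 := by
    ext x
    constructor
    · rintro ⟨t, ht, rfl⟩
      simpa using ht
    · intro hx
      have hx1 : (1 : ℝ) < x := hx
      exact ⟨Real.log x, Real.log_pos hx1, Real.exp_log (by linarith)⟩
  rw [← himg, integral_image_eq_integral_abs_deriv_smul measurableSet_Ioi
    (fun t _ => (Real.hasDerivAt_exp t).hasDerivWithinAt) Real.exp_injective.injOn]
  simp [abs_of_pos (Real.exp_pos _)]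

/-- The normalised error term of the prime number theorem in the logarithmic variable. -/
noncomputable def psiError (t : ℝ) : ℝ := psi (Real.exp t) * Real.exp (-t) - 1

lemma measurable_psiError : Measurable psiError :=
  ((psi_mono.measurable.comp Real.measurable_exp).mul (by fun_prop)).sub_const 1

lemma psi_exp_mul_exp_neg_mem (t : ℝ) :
    psi (Real.exp t) * Real.exp (-t) ∈ Icc 0 (Real.log 4 + 4) := by
  have he := Real.exp_pos t
  refine ⟨mul_nonneg (psi_nonneg _) (Real.exp_pos _).le, ?_⟩
  rw [Real.exp_neg, ← div_eq_mul_inv, div_le_iff₀ he]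
  exact psi_le_const_mul_self he.le

lemma abs_psiError_le (t : ℝ) : |psiError t| ≤ Real.log 4 + 5 := by
  obtain ⟨h0, h1⟩ := psi_exp_mul_exp_neg_mem t
  have : 0 ≤ Real.log 4 := Real.log_nonneg (by norm_num)
  rw [psiError, abs_le]
  constructor <;> linarith

lemma monotone_psiError : Monotone fun t => (psiError t + 1) * Real.exp t := by
  have : (fun t => (psiError t + 1) * Real.exp t) = fun t => psi (Real.exp t) := by
    ext t
    rw [psiError, sub_add_cancel, mul_assoc, ← Real.exp_add]
    simp
  rw [this]
  exact psi_mono.comp Real.exp_monotone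

open ArithmeticFunction.vonMangoldt in
-- Modulo 1 there is a single residue class, so the Dirichlet-progression machinery specialises to
-- `-ζ'/ζ`.
lemma LFunctionResidueClassAux_one_eq {s : ℂ} (hs : 1 < s.re) :
    LFunctionResidueClassAux (1 : ZMod 1) s = LSeries (fun n => (ArithmeticFunction.vonMangoldt n : ℂ)) s - 1 / (s - 1) := by
  rw [eqOn_LFunctionResidueClassAux isUnit_one hs]
  have : residueClass (1 : ZMod 1) = fun n => ArithmeticFunction.vonMangoldt n := by
    ext n
    have hn : (n : ZMod 1) = 1 := Subsingleton.elim _ _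
    simp [residueClass, hn]
  simp [this]

open ArithmeticFunction in
lemma LSeries_vonMangoldt_eq_integral_psi {s : ℂ} (hs : 1 < s.re) :
    LSeries (fun n => (ArithmeticFunction.vonMangoldt n : ℂ)) s =
      s * ∫ x in Ioi (1 : ℝ), (psi x : ℂ) * (x : ℂ) ^ (-(s + 1)) := by
  rw [LSeries_eq_mul_integral_of_nonneg (fun n => ArithmeticFunction.vonMangoldt n) zero_le_one hs ?_
    fun _ => vonMangoldt_nonneg]
  · congr 2
    ext x
    rw [psi]
    push_cast
    rfl
  · refine Asymptotics.IsBigO.of_bound (Real.log 4 + 4) (.of_forall fun n => ?_)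
    have h := psi_le_const_mul_self (Nat.cast_nonneg (α := ℝ) n)
    have h0 := psi_nonneg (n : ℝ)
    have he : ∑ k ∈ Finset.Icc 1 n, vonMangoldt k = psi n := by
      rw [psi, Nat.floor_natCast]; rfl
    rw [he, Real.rpow_one, Real.norm_of_nonneg h0, Real.norm_of_nonneg n.cast_nonneg]
    exact h

open ArithmeticFunction.vonMangoldt in
-- The pole at `s = 0` cancels: with `A` the auxiliary function at `s + 1`, `(A + 1/s)/(s + 1) - 1/s
-- = (A - 1)/(s + 1)`.
lemma laplace_psiError {s : ℂ} (hs : 0 < s.re) :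
    ∫ t in Ioi (0 : ℝ), (psiError t : ℂ) * Complex.exp (-s * t) =
      (LFunctionResidueClassAux (1 : ZMod 1) (s + 1) - 1) / (s + 1) := by
  have hs1 : 1 < (s + 1).re := by simpa using hs
  have hs0 : s ≠ 0 := fun h => by simp [h] at hs
  have hs10 : s + 1 ≠ 0 := fun h => by simp [h] at hs1; linarith
  have hexp : IntegrableOn (fun t : ℝ => Complex.exp (-s * t)) (Ioi 0) :=
    integrableOn_exp_mul_complex_Ioi (by simpa using hs) 0
  have hexpi : ∫ t in Ioi (0 : ℝ), Complex.exp (-s * t) = 1 / s := by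
    rw [integral_exp_mul_complex_Ioi (by simpa using hs)]
    simp [neg_div_neg_eq]
  have hpsi : IntegrableOn (fun t : ℝ => ((psi (Real.exp t) * Real.exp (-t) : ℝ) : ℂ) *
      Complex.exp (-s * t)) (Ioi 0) := by
    refine Integrable.bdd_mul (c := Real.log 4 + 4) hexp
      (Complex.measurable_ofReal.comp ((psi_mono.measurable.comp Real.measurable_exp).mul
        (by fun_prop))).aestronglyMeasurable (.of_forall fun t => ?_)
    obtain ⟨h0, h1⟩ := psi_exp_mul_exp_neg_mem t
    rwa [Complex.norm_real, Real.norm_of_nonneg h0]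
  have hsub : ∀ t : ℝ, (psiError t : ℂ) * Complex.exp (-s * t) =
      ((psi (Real.exp t) * Real.exp (-t) : ℝ) : ℂ) * Complex.exp (-s * t) -
        Complex.exp (-s * t) := fun t => by
    rw [psiError]; push_cast; ring
  have hL := LSeries_vonMangoldt_eq_integral_psi hs1
  rw [integral_Ioi_one_eq_integral_exp] at hL
  have hcong : ∫ t in Ioi (0 : ℝ), (Real.exp t : ℂ) *
      ((psi (Real.exp t) : ℂ) * (Real.exp t : ℂ) ^ (-(s + 1 + 1))) =
      ∫ t in Ioi (0 : ℝ), ((psi (Real.exp t) * Real.exp (-t) : ℝ) : ℂ) * Complex.exp (-s * t) := by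
    refine integral_congr_ae (.of_forall fun t => ?_)
    have hcp : (Real.exp t : ℂ) ^ (-(s + 1 + 1)) = Complex.exp (t * (-(s + 1 + 1))) := by
      rw [Complex.cpow_def_of_ne_zero (by exact_mod_cast (Real.exp_pos t).ne'),
        ← Complex.ofReal_log (Real.exp_pos t).le, Real.log_exp]
    simp only [hcp]
    push_cast
    rw [show (t : ℂ) * (-(s + 1 + 1)) = -t + (-t + -s * t) by ring, Complex.exp_add,
      Complex.exp_add, Complex.exp_neg]
    field_simp
  rw [hcong] at hL
  simp_rw [hsub]
  rw [integral_sub hpsi hexp, hexpi, LFunctionResidueClassAux_one_eq hs1, hL, add_sub_cancel_right]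
  field_simp
  ring

open ArithmeticFunction.vonMangoldt in
lemma tendsto_psiError : Tendsto psiError atTop (𝓝 0) := by
  refine tendsto_zero_of_laplace measurable_psiError abs_psiError_le monotone_psiError
    (H := fun s => (LFunctionResidueClassAux (1 : ZMod 1) (s + 1) - 1) / (s + 1))
    ?_ fun s hs => laplace_psiError hs
  -- The arithmetic input: this continuity up to `Re s = 1` rests on the non-vanishing of `ζ` there.
  refine ContinuousOn.div (((continuousOn_LFunctionResidueClassAux (1 : ZMod 1)).comp
    (by fun_prop) fun s hs => ?_).sub continuousOn_const) (by fun_prop) fun s hs h => ?_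
  · simpa using hs
  · have h1 := congrArg Complex.re h
    have h2 : 0 ≤ s.re := hs
    simp at h1
    linarith

/-- The prime number theorem for the Chebyshev function `ψ`. -/
theorem tendsto_psi_div : Tendsto (fun x => psi x / x) atTop (𝓝 1) := by
  have h := (tendsto_psiError.comp Real.tendsto_log_atTop).add_const 1
  rw [zero_add] at h
  refine h.congr' ?_
  filter_upwards [eventually_gt_atTop 0] with x hx
  simp [psiError, Real.exp_neg, Real.exp_log hx, div_eq_mul_inv]

/-- The prime number theorem for the Chebyshev function `θ`. -/
theorem tendsto_theta_div : Tendsto (fun x => theta x / x) atTop (𝓝 1) := by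
  have h0 : Tendsto (fun x => (psi x - theta x) / x) atTop (𝓝 0) := by
    refine (isBigO_psi_sub_theta_sqrt.trans_isLittleO ?_).tendsto_div_nhds_zero
    rw [Asymptotics.isLittleO_iff_tendsto' (by
      filter_upwards [eventually_gt_atTop 0] with x hx h using absurd h hx.ne')]
    refine (tendsto_inv_atTop_zero.comp Real.tendsto_sqrt_atTop).congr fun x => ?_
    simp [Real.sqrt_div_self']
  have h := tendsto_psi_div.sub h0
  rw [sub_zero] at h
  refine h.congr fun x => ?_
  ring

/-- The prime number theorem. -/
theorem tendsto_primePi_mul_log_div :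
    Tendsto (fun x => (primePi x : ℝ) * Real.log x / x) atTop (𝓝 1) := by
  have h0 : Tendsto (fun x => (Nat.primeCounting ⌊x⌋₊ - theta x / Real.log x) /
      (x / Real.log x)) atTop (𝓝 0) := by
    refine (primeCounting_sub_theta_div_log_isBigO.trans_isLittleO ?_).tendsto_div_nhds_zero
    rw [Asymptotics.isLittleO_iff_tendsto' (by
      filter_upwards [eventually_gt_atTop 1] with x hx h
      have := Real.log_pos hx
      have : x / Real.log x ≠ 0 := by positivity
      exact absurd h this)]
    refine (tendsto_inv_atTop_zero.comp Real.tendsto_log_atTop).congr' ?_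
    filter_upwards [eventually_gt_atTop 1] with x hx
    have := Real.log_pos hx
    simp only [Function.comp_apply]
    field_simp
  have h := h0.add tendsto_theta_div
  rw [zero_add] at h
  refine h.congr' ?_
  filter_upwards [eventually_gt_atTop 1] with x hx
  have := Real.log_pos hx
  rw [primePi]
  field_simp
  ring

end TMatrix

/-! ### Leading elements of the matrix -/

namespace TMatrix

lemma count_prime_five : Nat.count Nat.Prime 5 = 2 := by decide

lemma nth_prime_two : Nat.nth Nat.Prime 2 = 5 := by
  rw [← count_prime_five, Nat.nth_count Nat.prime_five]

/-- `Nat.nth` counts from 0, so the prime number `k + 2` has index `k + 1`. -/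
lemma p_eq_nth (k : ℕ+) : p k = Nat.nth Nat.Prime (k + 1) := by
  simp [p, nthPrime]

lemma prime_p (k : ℕ+) : (p k).Prime := by
  rw [p_eq_nth]; exact Nat.prime_nth_prime _

lemma five_le_p (k : ℕ+) : 5 ≤ p k := by
  rw [p_eq_nth, ← nth_prime_two]
  have := k.pos
  exact Nat.nth_monotone Nat.infinite_setOfPred_prime (by omega)

lemma exists_p_eq {q : ℕ} (hq : q.Prime) (h5 : 5 ≤ q) : ∃ k, p k = q := by
  have h2 : 2 ≤ Nat.count Nat.Prime q := count_prime_five ▸ Nat.count_monotone _ h5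
  obtain ⟨k, hk⟩ : ∃ k : ℕ+, (k : ℕ) = Nat.count Nat.Prime q - 1 := ⟨⟨_, by omega⟩, rfl⟩
  refine ⟨k, ?_⟩
  rw [p_eq_nth, hk, Nat.sub_add_cancel (by omega), Nat.nth_count hq]

/-- The column factors of `T` are the integers `≥ 5` coprime to `6`. -/
lemma exists_column_eq {q : ℕ} (hq : q.Prime) (h5 : 5 ≤ q) :
    ∃ n : ℕ+, 5 + 2 * ((n : ℕ) / 2) + 4 * (((n : ℕ) - 1) / 2) = q := by
  have h2 : ¬ 2 ∣ q := fun h => by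
    have := (Nat.prime_dvd_prime_iff_eq Nat.prime_two hq).1 h; omega
  have h3 : ¬ 3 ∣ q := fun h => by
    have := (Nat.prime_dvd_prime_iff_eq Nat.prime_three hq).1 h; omega
  have h6 : q % 6 = 1 ∨ q % 6 = 5 := by omega
  -- Column `2m` has factor `6m + 1` and column `2m + 1` has factor `6m + 5`.
  rcases h6 with h | h
  · refine ⟨⟨2 * (q / 6), by omega⟩, ?_⟩
    rw [PNat.mk_coe]; omega
  · refine ⟨⟨2 * (q / 6) + 1, by omega⟩, ?_⟩
    rw [PNat.mk_coe]; omega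

lemma leadingElements_eq : leadingElements = (· ^ 2) '' {q : ℕ | q.Prime ∧ 5 ≤ q} := by
  ext a
  constructor
  · rintro ⟨k, n, h, rfl⟩
    exact ⟨p k, ⟨prime_p k, five_le_p k⟩, h.symm⟩
  · rintro ⟨q, ⟨hq, h5⟩, rfl⟩
    obtain ⟨k, hk⟩ := exists_p_eq hq h5
    obtain ⟨n, hn⟩ := exists_column_eq hq h5
    have hT : T k n = q ^ 2 := by
      rw [T, Matrix.of_apply, hn, hk, sq]
    exact ⟨k, n, by rw [IsLeading, hT, hk], hT⟩

/-- The primes 2 and 3 are the two not represented; `x ≥ 9` puts both below or at `√x`. -/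
lemma leadingCounting_add_two {x : ℝ} (hx : 9 ≤ x) :
    leadingCounting x + 2 = primePi (Real.sqrt x) := by
  have hN : 3 ≤ ⌊Real.sqrt x⌋₊ := Nat.le_floor (Real.le_sqrt_of_sq_le (by norm_num; linarith))
  set N := ⌊Real.sqrt x⌋₊ with hNdef
  have hset : {a : ℕ | a ∈ leadingElements ∧ (a : ℝ) ≤ x} =
      (· ^ 2) '' (((Nat.primesLE N).filter (5 ≤ ·) : Finset ℕ) : Set ℕ) := by
    rw [leadingElements_eq]
    have hiff : ∀ q : ℕ, ((q ^ 2 : ℕ) : ℝ) ≤ x ↔ q ≤ N := fun q => by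
      rw [hNdef, Nat.le_floor_iff (Real.sqrt_nonneg x), Real.le_sqrt (Nat.cast_nonneg q)
        (by linarith)]
      push_cast
      rfl
    ext a
    constructor
    · rintro ⟨⟨q, ⟨hq, h5⟩, rfl⟩, hle⟩
      refine ⟨q, ?_, rfl⟩
      simp only [Finset.coe_filter, Nat.mem_primesLE, mem_ofPred_eq]
      exact ⟨⟨(hiff q).1 hle, hq⟩, h5⟩
    · rintro ⟨q, hq, rfl⟩
      simp only [Finset.coe_filter, Nat.mem_primesLE, mem_ofPred_eq] at hq
      exact ⟨⟨q, ⟨hq.1.2, hq.2⟩, rfl⟩, (hiff q).2 hq.1.1⟩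
  have hsmall : (Nat.primesLE N).filter (¬ 5 ≤ ·) = {2, 3} := by
    ext q
    simp only [Finset.mem_filter, Nat.mem_primesLE, Finset.mem_insert, Finset.mem_singleton]
    constructor
    · rintro ⟨⟨-, hq⟩, h5⟩
      have := hq.two_le
      have h4 : q ≠ 4 := by rintro rfl; revert hq; decide
      omega
    · rintro (rfl | rfl)
      · exact ⟨⟨by omega, Nat.prime_two⟩, by norm_num⟩
      · exact ⟨⟨by omega, Nat.prime_three⟩, by norm_num⟩
  have hcard := Finset.card_filter_add_card_filter_not (s := Nat.primesLE N) (5 ≤ ·)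
  rw [hsmall] at hcard
  rw [leadingCounting, hset, ncard_image_of_injective _ (Nat.pow_left_injective two_ne_zero),
    ncard_coe_finset, primePi, ← Nat.primesLE_card_eq_primeCounting, ← hcard]
  rfl

lemma tendsto_leadingCounting :
    Tendsto (fun x => (leadingCounting x : ℝ) / (2 * Real.sqrt x / Real.log x)) atTop (𝓝 1) := by
  -- The two missing primes contribute this negligible term, at `y = √x`.
  have hlog : Tendsto (fun y : ℝ => 2 * (Real.log y / y)) atTop (𝓝 0) := by
    simpa using Real.isLittleO_log_id_atTop.tendsto_div_nhds_zero.const_mul 2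
  have h := (tendsto_primePi_mul_log_div.sub hlog).comp Real.tendsto_sqrt_atTop
  rw [sub_zero] at h
  refine h.congr' ?_
  filter_upwards [eventually_ge_atTop 9] with x hx
  have hc : (leadingCounting x : ℝ) = primePi (Real.sqrt x) - 2 := by
    rw [← leadingCounting_add_two hx]; push_cast; ring
  have hs : 0 < Real.sqrt x := Real.sqrt_pos.2 (by linarith)
  have hl : 0 < Real.log x := Real.log_pos (by linarith)
  simp only [Function.comp_apply]
  rw [hc, Real.log_sqrt (by linarith)]
  field_simp

end TMatrix

theorem proposition4p24 :
    TMatrix.AsympEq (fun x => (TMatrix.leadingCounting x : ℝ))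
      (fun x => 2 * Real.sqrt x / Real.log x) ∧
    TMatrix.AsympEq (fun x => (TMatrix.primePi x : ℝ))
      (fun x => Real.sqrt x / 2 * (TMatrix.leadingCounting x : ℝ)) := by
  refine ⟨TMatrix.tendsto_leadingCounting, ?_⟩
  have h := TMatrix.tendsto_primePi_mul_log_div.div TMatrix.tendsto_leadingCounting one_ne_zero
  rw [div_one] at h
  refine h.congr' ?_
  filter_upwards [eventually_gt_atTop 1] with x hx
  have hs : 0 < Real.sqrt x := Real.sqrt_pos.2 (by linarith)
  have hl : 0 < Real.log x := Real.log_pos hx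
  have hx2 : x = Real.sqrt x ^ 2 := (Real.sq_sqrt (by linarith)).symm
  simp only [Pi.div_apply]
  -- Where the count is 0, both quotients are 0 by division by zero.
  rcases eq_or_ne (TMatrix.leadingCounting x : ℝ) 0 with h0 | h0
  · simp [h0]
  · rw [show (TMatrix.primePi x : ℝ) * Real.log x / x
      = (TMatrix.primePi x : ℝ) * Real.log x / Real.sqrt x ^ 2 by rw [← hx2]]
    field_simp
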